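/- Let $n\ge 1$ be an integer and write $[n]=\{0,1,\dots,n-1\}$. A matching in $[n]$ is a set of pairwise disjoint two-element subsets of $[n]$. Let $\alpha\in(0,1)$ (allowed to depend on $n$), and let $\tilde q$ be a probability measure on the set of matchings in $[n]$ such that $$\mathbb P_{M\sim\tilde q}\bigl(\{i,j\}\in M\bigr)\;\ge\;\frac{\alpha}{|j-i|}\qquad\text{for all } i,j\in[n] \text{ with } i\ne j .$$ Let $M_1,M_2,\dots$ be independent random matchings with law $\tilde q$, and let $x\in\{0,1\}^{[n]}$ be an arbitrary $0$–$1$ sequence. The parallel sorter started from $X_0=x$ obtains $X_t$ from $X_{t-1}$ by sorting, for every pair $\{i,j\}\in M_t$ with $i<j$, the labels at positions $i$ and $j$ (the smaller label is put at position $i$, the larger one at position $j$), leaving the labels at all other positions unchanged. Let $\tau_\star=\inf\{t\ge 0: X_t \text{ is non-decreasing}\}$ be the sorting time. Then $$\mathbb P\bigl(\tau_\star>50\,(\log n)/\alpha\bigr)\;\le\;\frac1{n^2},$$ where $\log$ is the natural logarithm. -/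

import Mathlib

open MeasureTheory ProbabilityTheory

/-- A matching in `[n]`: a finite set of pairs of distinct positions, any two different pairs
being disjoint. The positions `[n]` are `Fin n = {0, …, n - 1}`. -/
structure Matching (n : ℕ) where
  edges : Finset (Sym2 (Fin n))
  not_diag : ∀ e ∈ edges, ¬ e.IsDiag
  disjoint : ∀ e ∈ edges, ∀ f ∈ edges, ∀ v : Fin n, v ∈ e → v ∈ f → e = f

/-- The set of matchings is finite and every set of matchings is an event. -/
instance Matching.instMeasurableSpace (n : ℕ) : MeasurableSpace (Matching n) := ⊤

/-- The position matched with `i` in `M`, and `i` itself if `i` is unmatched. -/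
noncomputable def Matching.mate {n : ℕ} (M : Matching n) (i : Fin n) : Fin n :=
  open Classical in
  if h : ∃ j, s(i, j) ∈ M.edges then h.choose else i

theorem Matching.mate_eq {n : ℕ} (M : Matching n) {i j : Fin n} (h : s(i, j) ∈ M.edges) :
    M.mate i = j := by
  have hex : ∃ j, s(i, j) ∈ M.edges := ⟨j, h⟩
  have hm : M.mate i = hex.choose := by
    unfold Matching.mate
    exact dif_pos hex
  rw [hm]
  have heq := M.disjoint _ hex.choose_spec _ h i (Sym2.mem_mk_left _ _) (Sym2.mem_mk_left _ _)
  exact Sym2.congr_right.mp heq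

/-- One round of the parallel sorter with matching `M`: for each pair `{i, j} ∈ M`, the smaller of
the two labels goes to the smaller position and the larger one to the larger position; labels at
unmatched positions stay (see `sortStep_left`, `sortStep_right`, `sortStep_of_unmatched`). -/
noncomputable def sortStep {n : ℕ} {L : Type*} [LinearOrder L] (M : Matching n) (x : Fin n → L) :
    Fin n → L :=
  fun i => if i ≤ M.mate i then min (x i) (x (M.mate i)) else max (x i) (x (M.mate i))

theorem sortStep_left {n : ℕ} {L : Type*} [LinearOrder L] (M : Matching n) (x : Fin n → L)
    {i j : Fin n} (h : s(i, j) ∈ M.edges) (hij : i < j) :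
    sortStep M x i = min (x i) (x j) := by
  simp [sortStep, M.mate_eq h, hij.le]

theorem sortStep_right {n : ℕ} {L : Type*} [LinearOrder L] (M : Matching n) (x : Fin n → L)
    {i j : Fin n} (h : s(i, j) ∈ M.edges) (hij : i < j) :
    sortStep M x j = max (x i) (x j) := by
  have h' : s(j, i) ∈ M.edges := by rwa [Sym2.eq_swap]
  simp [sortStep, M.mate_eq h', hij, max_comm]

theorem sortStep_of_unmatched {n : ℕ} {L : Type*} [LinearOrder L] (M : Matching n) (x : Fin n → L)
    {i : Fin n} (h : ∀ j, s(i, j) ∉ M.edges) :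
    sortStep M x i = x i := by
  have hm : M.mate i = i := by
    unfold Matching.mate
    exact dif_neg (fun ⟨j, hj⟩ => h j hj)
  simp [sortStep, hm]

/-- The state of the list, started from `x`, after the first `t` of the matchings
`m 0, m 1, m 2, …` have been processed in this order. -/
noncomputable def sorterState {n : ℕ} {L : Type*} [LinearOrder L] (m : ℕ → Matching n)
    (x : Fin n → L) : ℕ → Fin n → L
  | 0 => x
  | t + 1 => sortStep (m t) (sorterState m x t)

/-- The sorting time: the least `t` such that the list is sorted after `t` rounds
(`⊤` if it is never sorted). -/
noncomputable def sortingTime {n : ℕ} {L : Type*} [LinearOrder L] (m : ℕ → Matching n)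
    (x : Fin n → L) : ℕ∞ :=
  ⨅ t ∈ {t : ℕ | Monotone (sorterState m x t)}, (t : ℕ∞)

/-- The class `𝒬_α`: the probability measures on matchings of `[n]` for which every pair `{i, j}`
of distinct positions belongs to the random matching with probability at least `α / |j - i|`. -/
def MatchingClass (n : ℕ) (α : ℝ) : Set (Measure (Matching n)) :=
  {q | IsProbabilityMeasure q ∧ ∀ i j : Fin n, i ≠ j →
    α / |((j : ℕ) : ℝ) - ((i : ℕ) : ℝ)| ≤ q.real {M | s(i, j) ∈ M.edges}}

/-! The inversion count serves as a potential. For a 0-1 sequence with a fixed number of ones it is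
an affine function of the sum of their positions, so swapping an inverted pair `(i, j)` lowers it by
exactly `j - i`, and the disjoint swaps of one matching contribute additively
(`inversionCount_sortStep`). The pair is compared with probability at least `α / (j - i)`,
independently of the current state. The distance cancels, so each inversion contributes at least `α`
to the expected drop, and the expected count contracts by `1 - α` per round
(`integral_inversionCount_succ_le`).

The count is at most `n ^ 2` initially and at least 1 in any unsorted state, so Markov's inequality
bounds the probability of being unsorted after `t` rounds by `(1 - α) ^ t * n ^ 2`. Taking `t` to be
the integer part of the time bound finishes the proof. -/

/-- The indicator that `M` contains the comparator `{i, j}` with `i < j` and that `x` is inverted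
at `(i, j)`. -/
noncomputable def comparatorSwap {n : ℕ} (M : Matching n) (x : Fin n → Fin 2) (i j : Fin n) : ℝ :=
  open Classical in
  (if i < j ∧ x i = 1 ∧ x j = 0 then 1 else 0) * (if s(i, j) ∈ M.edges then 1 else 0)

/-- The number of inversions of a `0`-`1` sequence. -/
noncomputable def inversionCount {n : ℕ} (x : Fin n → Fin 2) : ℝ :=
  ∑ i, ∑ j, if i < j ∧ x i = 1 ∧ x j = 0 then 1 else 0

theorem inversionCount_nonneg {n : ℕ} (x : Fin n → Fin 2) : 0 ≤ inversionCount x :=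
  Finset.sum_nonneg fun i _ => Finset.sum_nonneg fun j _ => by split_ifs <;> norm_num

theorem inversionCount_le {n : ℕ} (x : Fin n → Fin 2) : inversionCount x ≤ (n : ℝ) ^ 2 := by
  calc inversionCount x ≤ ∑ _i : Fin n, ∑ _j : Fin n, (1 : ℝ) :=
        Finset.sum_le_sum fun i _ => Finset.sum_le_sum fun j _ => by split_ifs <;> norm_num
    _ = (n : ℝ) ^ 2 := by simp [sq]

theorem one_le_inversionCount {n : ℕ} {x : Fin n → Fin 2} (hx : ¬ Monotone x) :
    1 ≤ inversionCount x := by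
  simp only [Monotone, not_forall] at hx
  obtain ⟨i, j, hij, h⟩ := hx
  have h1 : x i = 1 ∧ x j = 0 := by omega
  have hlt : i < j := lt_of_le_of_ne hij (by rintro rfl; simp at h)
  have h0 : ∀ a b : Fin n, (0 : ℝ) ≤ if a < b ∧ x a = 1 ∧ x b = 0 then 1 else 0 := fun a b => by
    split_ifs <;> norm_num
  calc (1 : ℝ) = if i < j ∧ x i = 1 ∧ x j = 0 then 1 else 0 := by simp [hlt, h1]
    _ ≤ ∑ b, if i < b ∧ x i = 1 ∧ x b = 0 then 1 else 0 :=
        Finset.single_le_sum (f := fun b => if i < b ∧ x i = 1 ∧ x b = 0 then (1 : ℝ) else 0)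
          (fun b _ => h0 i b) (Finset.mem_univ j)
    _ ≤ inversionCount x :=
        Finset.single_le_sum
          (f := fun a => ∑ b, if a < b ∧ x a = 1 ∧ x b = 0 then (1 : ℝ) else 0)
          (fun a _ => Finset.sum_nonneg fun b _ => h0 a b) (Finset.mem_univ i)

/-- The number of inversions is determined by the number of ones and the sum of their positions. -/
theorem inversionCount_eq {n : ℕ} (x : Fin n → Fin 2) :
    inversionCount x = ∑ i : Fin n, ((n : ℝ) - 1 - (i : ℕ)) * ((x i : ℕ) : ℝ)
      - ((∑ i, ((x i : ℕ) : ℝ)) ^ 2 - ∑ i, ((x i : ℕ) : ℝ)) / 2 := by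
  have hcard (i : Fin n) : ∑ j : Fin n, (if i < j then (1 : ℝ) else 0) = (n : ℝ) - 1 - (i : ℕ) := by
    rw [Finset.sum_boole]
    have : (Finset.univ.filter fun j => i < j) = Finset.Ioi i := by ext; simp
    rw [this, Fin.card_Ioi, Nat.sub_sub, Nat.cast_sub (by omega)]
    push_cast; ring
  -- These are the pairs of ones, to be removed from all pairs `i < j` with a one at `i`. The
  -- diagonal drops out because 0-1 labels are idempotent.
  have hsq : (∑ i, ((x i : ℕ) : ℝ)) ^ 2 - ∑ i, ((x i : ℕ) : ℝ)
      = 2 * ∑ i, ∑ j, if i < j then ((x i : ℕ) : ℝ) * ((x j : ℕ) : ℝ) else 0 := by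
    have hswap : ∑ i, ∑ j, (if i < j then ((x i : ℕ) : ℝ) * ((x j : ℕ) : ℝ) else 0)
        = ∑ i, ∑ j, if j < i then ((x i : ℕ) : ℝ) * ((x j : ℕ) : ℝ) else 0 := by
      rw [Finset.sum_comm]
      simp only [mul_comm]
    have hdiag : ∑ i, ((x i : ℕ) : ℝ)
        = ∑ i, ∑ j, if i = j then ((x i : ℕ) : ℝ) * ((x j : ℕ) : ℝ) else 0 := by
      refine Finset.sum_congr rfl fun i _ => ?_
      rw [Finset.sum_ite_eq]
      rcases (by omega : x i = 0 ∨ x i = 1) with h | h <;> simp [h]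
    rw [two_mul]
    nth_rewrite 2 [hswap]
    rw [hdiag, ← hdiag, sq, Finset.sum_mul_sum, hdiag, ← Finset.sum_sub_distrib,
      ← Finset.sum_add_distrib]
    refine Finset.sum_congr rfl fun i _ => ?_
    rw [← Finset.sum_sub_distrib, ← Finset.sum_add_distrib]
    refine Finset.sum_congr rfl fun j _ => ?_
    rcases lt_trichotomy i j with h | h | h
    · simp [h, h.ne, h.not_gt]
    · simp [h]
    · simp [h, h.ne', h.not_gt]
  rw [hsq, mul_div_cancel_left₀ _ two_ne_zero, inversionCount, ← Finset.sum_sub_distrib]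
  refine Finset.sum_congr rfl fun i _ => ?_
  rw [← hcard, Finset.sum_mul, ← Finset.sum_sub_distrib]
  refine Finset.sum_congr rfl fun j _ => ?_
  rcases (by omega : x i = 0 ∨ x i = 1) with h | h <;>
    rcases (by omega : x j = 0 ∨ x j = 1) with h' | h' <;> by_cases hij : i < j <;>
    simp [h, h', hij]

/-! ### Effect of one round on linear functionals and inversions -/

/-- Ones swapped into `i` minus ones swapped out of `i`. Only the partner of `i` can contribute to
the sum. -/
theorem sortStep_eq_add_sum {n : ℕ} (M : Matching n) (x : Fin n → Fin 2) (i : Fin n) :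
    (((sortStep M x i : Fin 2) : ℕ) : ℝ)
      = ((x i : ℕ) : ℝ) + ∑ j, (comparatorSwap M x j i - comparatorSwap M x i j) := by
  by_cases hex : ∃ j, s(i, j) ∈ M.edges
  · obtain ⟨j, hj⟩ := hex
    have hne : i ≠ j := fun h => M.not_diag _ hj (by simp [h])
    have hj' : s(j, i) ∈ M.edges := by rwa [Sym2.eq_swap]
    rw [Finset.sum_eq_single j]
    · rcases hne.lt_or_gt with hlt | hlt
      · rw [sortStep_left M x hj hlt]
        rcases (by omega : x i = 0 ∨ x i = 1) with h | h <;>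
          rcases (by omega : x j = 0 ∨ x j = 1) with h' | h' <;>
          simp [comparatorSwap, h, h', hlt, hlt.le, hj]
      · rw [sortStep_right M x hj' hlt]
        rcases (by omega : x i = 0 ∨ x i = 1) with h | h <;>
          rcases (by omega : x j = 0 ∨ x j = 1) with h' | h' <;>
          simp [comparatorSwap, h, h', hlt, hlt.le, hj']
    · intro b _ hb
      have h1 : s(i, b) ∉ M.edges := fun h => hb ((M.mate_eq h).symm.trans (M.mate_eq hj))
      have h2 : s(b, i) ∉ M.edges := by rwa [Sym2.eq_swap]
      simp [comparatorSwap, h1, h2]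
    · simp
  · push Not at hex
    have h2 (b : Fin n) : s(b, i) ∉ M.edges := by rw [Sym2.eq_swap]; exact hex b
    simp [sortStep_of_unmatched M x hex, comparatorSwap, hex, h2]

/-- Used with weight 1 (the number of ones is conserved) and with weight `n - 1 - i`, the linear
part of `inversionCount_eq`. -/
theorem sum_mul_sortStep {n : ℕ} (M : Matching n) (x : Fin n → Fin 2) (w : Fin n → ℝ) :
    ∑ i, w i * (((sortStep M x i : Fin 2) : ℕ) : ℝ)
      = ∑ i, w i * ((x i : ℕ) : ℝ) + ∑ i, ∑ j, (w j - w i) * comparatorSwap M x i j := by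
  simp only [sortStep_eq_add_sum, mul_add, Finset.sum_add_distrib, Finset.mul_sum, mul_sub, sub_mul,
    Finset.sum_sub_distrib]
  rw [Finset.sum_comm (f := fun i j => w i * comparatorSwap M x j i)]

/-- Each comparator that meets an inversion `(i, j)` lowers the number of inversions by `j - i`. -/
theorem inversionCount_sortStep {n : ℕ} (M : Matching n) (x : Fin n → Fin 2) :
    inversionCount (sortStep M x) = inversionCount x
      - ∑ i : Fin n, ∑ j : Fin n, (((j : ℕ) : ℝ) - ((i : ℕ) : ℝ)) * comparatorSwap M x i j := by
  have h1 : ∑ i, (((sortStep M x i : Fin 2) : ℕ) : ℝ) = ∑ i, ((x i : ℕ) : ℝ) := by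
    simpa using sum_mul_sortStep M x fun _ => 1
  have h2 := sum_mul_sortStep M x fun i => (n : ℝ) - 1 - (i : ℕ)
  simp only [sub_sub_sub_cancel_left] at h2
  have h3 : ∑ i : Fin n, ∑ j : Fin n, (((i : ℕ) : ℝ) - ((j : ℕ) : ℝ)) * comparatorSwap M x i j
      = -∑ i : Fin n, ∑ j : Fin n, (((j : ℕ) : ℝ) - ((i : ℕ) : ℝ)) * comparatorSwap M x i j := by
    simp only [← Finset.sum_neg_distrib, ← neg_mul, neg_sub]
  rw [inversionCount_eq, inversionCount_eq, h1, h2, h3]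
  ring

/-! ### Random matchings: measurability, independence, expected contraction -/

instance Matching.instFinite (n : ℕ) : Finite (Matching n) :=
  Finite.of_injective Matching.edges fun M N h => by cases M; cases N; simpa using h

instance Matching.instInhabited (n : ℕ) : Inhabited (Matching n) :=
  ⟨⟨∅, by simp, by simp⟩⟩

instance Matching.instDiscreteMeasurableSpace (n : ℕ) : DiscreteMeasurableSpace (Matching n) :=
  ⟨fun _ => trivial⟩

theorem sorterState_congr {n : ℕ} {L : Type*} [LinearOrder L] {m m' : ℕ → Matching n}
    (x : Fin n → L) {t : ℕ} (h : ∀ s < t, m s = m' s) : sorterState m x t = sorterState m' x t := by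
  induction t with
  | zero => rfl
  | succ t ih =>
    rw [sorterState, sorterState, ih fun s hs => h s (by omega), h t (by omega)]

/-- The state after `t` rounds is a function of the first `t` matchings. -/
theorem exists_sorterState_eq {n : ℕ} {Ω : Type*} (M : ℕ → Ω → Matching n) (x : Fin n → Fin 2) (t : ℕ) :
    ∃ f : (Finset.range t → Matching n) → Fin n → Fin 2,
      (fun ω => sorterState (fun s => M s ω) x t) = f ∘ fun ω s => M s ω := by
  -- The default matching fills rounds from `t` on, which the state after `t` rounds never sees.
  refine ⟨fun g => sorterState (fun s => if h : s ∈ Finset.range t then g ⟨s, h⟩ else default) x t,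
    ?_⟩
  funext ω
  exact sorterState_congr x fun s hs => by simp [hs]

section Random

variable {n : ℕ} {Ω : Type*} [MeasurableSpace Ω] {μ : Measure Ω} {M : ℕ → Ω → Matching n}

theorem measurable_sorterState (hmeas : ∀ t, Measurable (M t)) (x : Fin n → Fin 2) (t : ℕ) :
    Measurable fun ω => sorterState (fun s => M s ω) x t := by
  obtain ⟨f, hf⟩ := exists_sorterState_eq M x t
  rw [hf]
  exact (Measurable.of_discrete (f := f)).comp (measurable_pi_lambda _ fun s => hmeas s)

theorem indepFun_sorterState (hmeas : ∀ t, Measurable (M t)) (hindep : iIndepFun M μ)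
    (x : Fin n → Fin 2) (t : ℕ) :
    IndepFun (fun ω => sorterState (fun s => M s ω) x t) (M t) μ := by
  obtain ⟨f, hf⟩ := exists_sorterState_eq M x t
  rw [hf]
  have h := hindep.indepFun_finset (Finset.range t) {t} (by simp) hmeas
  exact h.comp (φ := f) (ψ := fun g : ({t} : Finset ℕ) → Matching n => g ⟨t, by simp⟩)
    Measurable.of_discrete Measurable.of_discrete

theorem integrable_of_finite_comp [IsFiniteMeasure μ] {β : Type*} [MeasurableSpace β]
    [DiscreteMeasurableSpace β] [Finite β] {Y : Ω → β} (hY : Measurable Y) (f : β → ℝ) :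
    Integrable (fun ω => f (Y ω)) μ := by
  obtain ⟨C, hC⟩ := (Set.finite_range fun b => ‖f b‖).bddAbove
  exact Integrable.of_bound ((Measurable.of_discrete (f := f)).comp hY).aestronglyMeasurable C
    (Filter.Eventually.of_forall fun ω => hC ⟨Y ω, rfl⟩)

theorem integrable_inversionCount [IsFiniteMeasure μ] (hmeas : ∀ t, Measurable (M t))
    (x : Fin n → Fin 2) (t : ℕ) :
    Integrable (fun ω => inversionCount (sorterState (fun s => M s ω) x t)) μ :=
  integrable_of_finite_comp (measurable_sorterState hmeas x t) inversionCount

variable {α : ℝ} {q : Measure (Matching n)}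

/-- The state depends on rounds before `t` only, so the expectation factors; the weight `j - i` then
cancels the denominator of the edge probability. -/
theorem le_integral_comparatorSwap (hq : q ∈ MatchingClass n α) (hmeas : ∀ t, Measurable (M t))
    (hlaw : ∀ t, μ.map (M t) = q) (hindep : iIndepFun M μ) (x : Fin n → Fin 2) (t : ℕ)
    (i j : Fin n) :
    α * ∫ ω, (if i < j ∧ sorterState (fun s => M s ω) x t i = 1 ∧
        sorterState (fun s => M s ω) x t j = 0 then (1 : ℝ) else 0) ∂μ
      ≤ ∫ ω, (((j : ℕ) : ℝ) - ((i : ℕ) : ℝ)) *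
          comparatorSwap (M t ω) (sorterState (fun s => M s ω) x t) i j ∂μ := by
  classical
  by_cases hij : i < j
  swap
  · simp [hij, comparatorSwap]
  have hd : (0 : ℝ) < ((j : ℕ) : ℝ) - ((i : ℕ) : ℝ) := sub_pos.2 (by exact_mod_cast hij)
  have hedge : ∫ ω, (if s(i, j) ∈ (M t ω).edges then (1 : ℝ) else 0) ∂μ
      = q.real {N | s(i, j) ∈ N.edges} := by
    rw [← hlaw t, map_measureReal_apply (hmeas t) (MeasurableSet.of_discrete),
      ← integral_indicator_one (hmeas t (MeasurableSet.of_discrete))]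
    exact integral_congr_ae (Filter.Eventually.of_forall fun ω => by
      simp [Set.indicator_apply])
  have hprob := hq.2 i j hij.ne
  rw [abs_of_pos hd, div_le_iff₀ hd] at hprob
  have hmul := ((indepFun_sorterState hmeas hindep x t).comp
    (φ := fun y : Fin n → Fin 2 => if i < j ∧ y i = 1 ∧ y j = 0 then (1 : ℝ) else 0)
    (ψ := fun N : Matching n => if s(i, j) ∈ N.edges then (1 : ℝ) else 0)
    Measurable.of_discrete Measurable.of_discrete).integral_fun_mul_eq_mul_integral
    (Measurable.of_discrete.comp (measurable_sorterState hmeas x t)).aestronglyMeasurable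
    (Measurable.of_discrete.comp (hmeas t)).aestronglyMeasurable
  simp only [Function.comp_apply] at hmul
  simp only [comparatorSwap]
  rw [integral_const_mul, hmul, hedge]
  have h0 : 0 ≤ ∫ ω, (if i < j ∧ sorterState (fun s => M s ω) x t i = 1 ∧
      sorterState (fun s => M s ω) x t j = 0 then (1 : ℝ) else 0) ∂μ :=
    integral_nonneg fun ω => by dsimp only; split_ifs <;> norm_num
  nlinarith [mul_le_mul_of_nonneg_right hprob h0]

variable [IsProbabilityMeasure μ]

theorem integral_inversionCount_succ_le (hq : q ∈ MatchingClass n α)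
    (hmeas : ∀ t, Measurable (M t)) (hlaw : ∀ t, μ.map (M t) = q) (hindep : iIndepFun M μ)
    (x : Fin n → Fin 2) (t : ℕ) :
    ∫ ω, inversionCount (sorterState (fun s => M s ω) x (t + 1)) ∂μ
      ≤ (1 - α) * ∫ ω, inversionCount (sorterState (fun s => M s ω) x t) ∂μ := by
  have hY := measurable_sorterState hmeas x t
  have hint (i j : Fin n) : Integrable (fun ω => (((j : ℕ) : ℝ) - ((i : ℕ) : ℝ)) *
      comparatorSwap (M t ω) (sorterState (fun s => M s ω) x t) i j) μ :=
    integrable_of_finite_comp ((hmeas t).prodMk hY)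
      fun p : Matching n × (Fin n → Fin 2) =>
        (((j : ℕ) : ℝ) - ((i : ℕ) : ℝ)) * comparatorSwap p.1 p.2 i j
  have hinv : ∫ ω, inversionCount (sorterState (fun s => M s ω) x t) ∂μ
      = ∑ i : Fin n, ∑ j : Fin n, ∫ ω, (if i < j ∧ sorterState (fun s => M s ω) x t i = 1 ∧
        sorterState (fun s => M s ω) x t j = 0 then (1 : ℝ) else 0) ∂μ := by
    have hint' (i j : Fin n) : Integrable (fun ω =>
        if i < j ∧ sorterState (fun s => M s ω) x t i = 1 ∧
          sorterState (fun s => M s ω) x t j = 0 then (1 : ℝ) else 0) μ :=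
      integrable_of_finite_comp hY
        fun y : Fin n → Fin 2 => if i < j ∧ y i = 1 ∧ y j = 0 then (1 : ℝ) else 0
    simp only [inversionCount]
    rw [integral_finsetSum _ fun i _ => integrable_finsetSum _ fun j _ => hint' i j]
    exact Finset.sum_congr rfl fun i _ => integral_finsetSum _ fun j _ => hint' i j
  simp only [sorterState, inversionCount_sortStep]
  rw [integral_sub (integrable_inversionCount hmeas x t)
      (integrable_finsetSum _ fun i _ => integrable_finsetSum _ fun j _ => hint i j),
    integral_finsetSum _ fun i _ => integrable_finsetSum _ fun j _ => hint i j, sub_mul, one_mul]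
  refine sub_le_sub_left ?_ _
  rw [hinv, Finset.mul_sum]
  refine Finset.sum_le_sum fun i _ => ?_
  rw [integral_finsetSum _ fun j _ => hint i j, Finset.mul_sum]
  exact Finset.sum_le_sum fun j _ => le_integral_comparatorSwap hq hmeas hlaw hindep x t i j

theorem integral_inversionCount_le (hα1 : α ≤ 1) (hq : q ∈ MatchingClass n α)
    (hmeas : ∀ t, Measurable (M t)) (hlaw : ∀ t, μ.map (M t) = q) (hindep : iIndepFun M μ)
    (x : Fin n → Fin 2) (t : ℕ) :
    ∫ ω, inversionCount (sorterState (fun s => M s ω) x t) ∂μ ≤ (1 - α) ^ t * (n : ℝ) ^ 2 := by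
  induction t with
  | zero => simpa [sorterState] using inversionCount_le x
  | succ t ih =>
    calc _ ≤ (1 - α) * ∫ ω, inversionCount (sorterState (fun s => M s ω) x t) ∂μ :=
          integral_inversionCount_succ_le hq hmeas hlaw hindep x t
      _ ≤ (1 - α) * ((1 - α) ^ t * (n : ℝ) ^ 2) :=
          mul_le_mul_of_nonneg_left ih (by linarith)
      _ = _ := by ring

/-- Markov's inequality for the number of inversions. -/
theorem measureReal_not_monotone_sorterState_le (hα1 : α ≤ 1) (hq : q ∈ MatchingClass n α)
    (hmeas : ∀ t, Measurable (M t)) (hlaw : ∀ t, μ.map (M t) = q) (hindep : iIndepFun M μ)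
    (x : Fin n → Fin 2) (t : ℕ) :
    μ.real {ω | ¬ Monotone (sorterState (fun s => M s ω) x t)} ≤ (1 - α) ^ t * (n : ℝ) ^ 2 := by
  calc _ ≤ μ.real {ω | 1 ≤ inversionCount (sorterState (fun s => M s ω) x t)} :=
        measureReal_mono fun ω hω => one_le_inversionCount hω
    _ ≤ ∫ ω, inversionCount (sorterState (fun s => M s ω) x t) ∂μ := by
        simpa using mul_meas_ge_le_integral_of_nonneg
          (Filter.Eventually.of_forall fun ω => inversionCount_nonneg _)
          (integrable_inversionCount (μ := μ) hmeas x t) 1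
    _ ≤ _ := integral_inversionCount_le hα1 hq hmeas hlaw hindep x t

end Random

/-! ### From the sorting time to a fixed round, and the numerical bound -/

theorem not_monotone_of_lt_sortingTime {n : ℕ} {L : Type*} [LinearOrder L] {m : ℕ → Matching n}
    {x : Fin n → L} {T : ℝ} (hT : 0 ≤ T)
    (h : ENNReal.ofReal T < (sortingTime m x : ENNReal)) :
    ¬ Monotone (sorterState m x ⌊T⌋₊) := by
  intro hm
  have h1 : sortingTime m x ≤ (⌊T⌋₊ : ℕ∞) := 
    iInf₂_le (f := fun (t : ℕ) (_ : t ∈ {t : ℕ | Monotone (sorterState m x t)}) => (t : ℕ∞)) _ hm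
  have h2 : (sortingTime m x : ENNReal) ≤ ((⌊T⌋₊ : ℕ∞) : ENNReal) := by exact_mod_cast h1
  refine absurd (h.trans_le h2) (not_lt.2 ?_)
  rw [ENat.toENNReal_coe, ← ENNReal.ofReal_natCast]
  exact ENNReal.ofReal_le_ofReal (Nat.floor_le hT)

theorem one_sub_pow_floor_mul_sq_le {n : ℕ} (hn : 2 ≤ n) {α : ℝ} (hα0 : 0 < α) (hα1 : α < 1) :
    (1 - α) ^ ⌊50 * Real.log n / α⌋₊ * (n : ℝ) ^ 2 ≤ 1 / (n : ℝ) ^ 2 := by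
  have hn2 : (2 : ℝ) ≤ n := by exact_mod_cast hn
  have hn0 : (0 : ℝ) < n := by linarith
  -- This pays for the floor: `k * α ≥ 50 log n - α ≥ 50 log n - 1 ≥ 48 log n`, while only `4 log n`
  -- is needed.
  have hlog : (1 / 2 : ℝ) ≤ Real.log n :=
    (by linarith [Real.log_two_gt_d9] : (1 / 2 : ℝ) ≤ Real.log 2).trans
      (Real.log_le_log two_pos hn2)
  set k := ⌊50 * Real.log n / α⌋₊
  have hk : 50 * Real.log n ≤ (k + 1) * α := by
    rw [← div_le_iff₀ hα0]
    exact (Nat.lt_floor_add_one _).le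
  have hpow : (1 - α) ^ k ≤ Real.exp (-(4 * Real.log n)) :=
    calc (1 - α) ^ k ≤ Real.exp (-α) ^ k :=
          pow_le_pow_left₀ (by linarith) (Real.one_sub_le_exp_neg α) k
      _ = Real.exp (-(k * α)) := by rw [← Real.exp_nat_mul]; ring_nf
      _ ≤ _ := Real.exp_le_exp.2 (by nlinarith)
  have hexp : Real.exp (-(4 * Real.log n)) = 1 / (n : ℝ) ^ 4 := by
    rw [Real.exp_neg, show (4 : ℝ) * Real.log n = (4 : ℕ) * Real.log n by norm_num,
      Real.exp_nat_mul, Real.exp_log hn0, one_div]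
  calc (1 - α) ^ k * (n : ℝ) ^ 2 ≤ 1 / (n : ℝ) ^ 4 * (n : ℝ) ^ 2 :=
        mul_le_mul_of_nonneg_right (hpow.trans hexp.le) (by positivity)
    _ = 1 / (n : ℝ) ^ 2 := by field_simp

theorem mainTheorem3 (n : ℕ) (hn : 1 ≤ n) (α : ℝ) (hα0 : 0 < α) (hα1 : α < 1)
    (q : Measure (Matching n)) (hq : q ∈ MatchingClass n α)
    {Ω : Type*} [MeasurableSpace Ω] (μ : Measure Ω) [IsProbabilityMeasure μ]
    (M : ℕ → Ω → Matching n) (hmeas : ∀ t, Measurable (M t))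
    (hlaw : ∀ t, μ.map (M t) = q) (hindep : iIndepFun M μ)
    (x : Fin n → Fin 2) :
    μ.real {ω | ENNReal.ofReal (50 * Real.log n / α) <
        (sortingTime (fun t => M t ω) x : ENNReal)} ≤ 1 / (n : ℝ) ^ 2 := by
  -- For `n = 1` the right-hand side is 1; the numerical bound needs `n ≥ 2`.
  rcases hn.eq_or_lt with rfl | hn2
  · simp
  have hT : 0 ≤ 50 * Real.log n / α :=
    div_nonneg (mul_nonneg (by norm_num) (Real.log_natCast_nonneg n)) hα0.le
  calc _ ≤ μ.real {ω | ¬ Monotone (sorterState (fun t => M t ω) x ⌊50 * Real.log n / α⌋₊)} :=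
        measureReal_mono fun ω hω => not_monotone_of_lt_sortingTime hT hω
    _ ≤ _ := measureReal_not_monotone_sorterState_le hα1.le hq hmeas hlaw hindep x _
    _ ≤ _ := one_sub_pow_floor_mul_sq_le hn2 hα0 hα1
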